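/- Let $F$ be a field and let $D$ be a subring of $F$ (not necessarily with quotient field $F$). A valuation ring of $F$ is a subring $V$ of $F$ such that $x \in V$ or $x^{-1} \in V$ for each nonzero $x \in F$. Let $\mathfrak{X}$ be the Zariski–Riemann space of $F/D$, that is, the set of all valuation rings of $F$ that contain $D$, with the topology that has the sets $\{V \in \mathfrak{X} : t_1,\ldots,t_m \in V\}$, $t_1,\ldots,t_m \in F$, as basic open sets. A subspace $Z \subseteq \mathfrak{X}$ with $F \in Z$ is viewed as a locally ringed space with the structure sheaf $\mathcal{O}_Z(U) = \bigcap_{V \in U} V$ for nonempty open subsets $U$ of $Z$ (and $\mathcal{O}_Z(\emptyset) = 0$), with inclusions as restriction maps. It has a structure morphism $Z \to \operatorname{Spec}(D)$, which sends $V \in Z$ to its center in $D$ (the intersection of $D$ with the maximal ideal of $V$) and is given on sections by inclusion; likewise for $\mathfrak{X}$. A $D$-morphism is a morphism of locally ringed spaces that commutes with the structure morphisms to $\operatorname{Spec}(D)$. Let $Z$ be a subspace of $\mathfrak{X}$ with $F \in Z$, let $n \geq 0$, and let $j : Z \to \mathfrak{X}$ be the inclusion morphism (the inclusion on points, and on sections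 the inclusions $\mathcal{O}_{\mathfrak{X}}(U) \subseteq \mathcal{O}_Z(U \cap Z)$ for nonempty open $U$). Then for every $D$-morphism $\phi : Z \to \mathbb{P}^n_D = \operatorname{Proj}(D[T_0,\ldots,T_n])$ there is a unique $D$-morphism $\widetilde{\phi} : \mathfrak{X} \to \mathbb{P}^n_D$ that lifts $\phi$, that is, such that $\widetilde{\phi} \circ j = \phi$. -/

import Mathlib

open CategoryTheory TopologicalSpace Opposite AlgebraicGeometry

universe u

noncomputable section

/-- The set of all valuation rings of the field `F` that contain the subring `D`. -/
def ZariskiRiemann {F : Type u} [Field F] (D : Subring F) : Type u :=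
  {V : ValuationSubring F // D ≤ V.toSubring}

namespace ZariskiRiemann

section

variable {F : Type u} [Field F] {D : Subring F}

/-- The basic open set of all valuation rings that contain the finitely many elements of `t`. -/
def basicOpen (D : Subring F) (t : Finset F) : Set (ZariskiRiemann D) :=
  {V | ∀ x ∈ t, x ∈ V.1}

instance : TopologicalSpace (ZariskiRiemann D) :=
  TopologicalSpace.generateFrom (Set.range (basicOpen D))

variable (D) in
/-- The field `F`, as a (trivial) valuation ring of `F` containing `D`. -/
def generic : ZariskiRiemann D := ⟨⊤, fun _ _ => ValuationSubring.mem_top _⟩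

theorem isOpen_basicOpen (t : Finset F) : IsOpen (basicOpen D t) :=
  TopologicalSpace.isOpen_generateFrom_of_mem ⟨t, rfl⟩

theorem generic_mem_of_isOpen {O : Set (ZariskiRiemann D)} (hO : IsOpen O)
    {V : ZariskiRiemann D} (hV : V ∈ O) : generic D ∈ O := by
  induction hO with
  | basic s hs =>
    obtain ⟨t, rfl⟩ := hs
    exact fun x _ => ValuationSubring.mem_top x
  | univ => trivial
  | inter s t _ _ ihs iht => exact ⟨ihs hV.1, iht hV.2⟩
  | sUnion S _ ih =>
    obtain ⟨s, hs, hVs⟩ := hV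
    exact ⟨s, hs, ih s hs hVs⟩

/-- The subset `Z` of the Zariski-Riemann space, with the subspace topology. -/
abbrev top (Z : Set (ZariskiRiemann D)) : TopCat.{u} := TopCat.of Z

variable {Z : Set (ZariskiRiemann D)}

theorem generic_mem_opens (hZ : generic D ∈ Z) (U : Opens (top Z)) {x : top Z} (hx : x ∈ U) :
    (⟨generic D, hZ⟩ : Z) ∈ U := by
  obtain ⟨O, hO, hU⟩ := isOpen_induced_iff.mp U.isOpen
  have h : ∀ y : Z, y ∈ U ↔ y.1 ∈ O := fun y => by
    rw [← SetLike.mem_coe, ← hU]; rfl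
  exact (h _).mpr (generic_mem_of_isOpen hO ((h x).mp hx))

/-- The ring of sections over `U` of the holomorphy sheaf of `Z`: the constant functions on `U`
whose value lies in each of the valuation rings in `U`. If `U` is nonempty, this is the intersection
of the valuation rings in `U` (see `sectionsEquiv`); if `U` is empty, it is the trivial ring. -/
def sections (U : Opens (top Z)) : Subring (U → F) where
  carrier := {f | ∃ c : F, ∀ x : U, f x = c ∧ c ∈ x.1.1.1}
  zero_mem' := ⟨0, fun _ => ⟨rfl, zero_mem _⟩⟩
  one_mem' := ⟨1, fun _ => ⟨rfl, one_mem _⟩⟩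
  add_mem' := by
    rintro f g ⟨a, ha⟩ ⟨b, hb⟩
    exact ⟨a + b, fun x => ⟨by simp [ha x, hb x], add_mem (ha x).2 (hb x).2⟩⟩
  neg_mem' := by
    rintro f ⟨a, ha⟩
    exact ⟨-a, fun x => ⟨by simp [ha x], neg_mem (ha x).2⟩⟩
  mul_mem' := by
    rintro f g ⟨a, ha⟩ ⟨b, hb⟩
    exact ⟨a * b, fun x => ⟨by simp [ha x, hb x], mul_mem (ha x).2 (hb x).2⟩⟩

/-- The constant section of the holomorphy sheaf with value `c`. -/
def constSection (U : Opens (top Z)) (c : F) (hc : ∀ x : U, c ∈ x.1.1.1) : sections U :=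
  ⟨fun _ => c, c, fun x => ⟨rfl, hc x⟩⟩

theorem sections_apply_mem {U : Opens (top Z)} (s : sections U) (x : U) : s.1 x ∈ x.1.1.1 := by
  obtain ⟨c, hc⟩ := s.2
  rw [(hc x).1]
  exact (hc x).2

theorem sections_apply_eq {U : Opens (top Z)} (s : sections U) (x y : U) : s.1 x = s.1 y := by
  obtain ⟨c, hc⟩ := s.2
  rw [(hc x).1, (hc y).1]

/-- Over a nonempty open set `U`, the holomorphy sheaf is the intersection of the valuation
rings in `U`. -/
def sectionsEquiv (U : Opens (top Z)) [Nonempty U] :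
    sections U ≃+* (⨅ x : U, x.1.1.1.toSubring : Subring F) where
  toFun s := ⟨s.1 (Classical.arbitrary U), by
    rw [Subring.mem_iInf]
    intro x
    rw [sections_apply_eq s _ x]
    exact sections_apply_mem s x⟩
  invFun c := constSection U c.1 fun x => Subring.mem_iInf.mp c.2 x
  left_inv s := Subtype.ext (funext fun x => sections_apply_eq s _ x)
  right_inv _ := rfl
  map_add' _ _ := rfl
  map_mul' _ _ := rfl

/-- The restriction map from `V` to `U` of the holomorphy sheaf. -/
def res {U V : Opens (top Z)} (h : U ≤ V) : sections V →+* sections U where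
  toFun s := ⟨fun x => s.1 ⟨x.1, h x.2⟩, s.2.imp fun _ hc x => hc ⟨x.1, h x.2⟩⟩
  map_one' := rfl
  map_mul' _ _ := rfl
  map_zero' := rfl
  map_add' _ _ := rfl

/-- The holomorphy presheaf of `Z`. -/
def holomorphyPresheaf (Z : Set (ZariskiRiemann D)) : TopCat.Presheaf CommRingCat.{u} (top Z) where
  obj U := CommRingCat.of (sections U.unop)
  map i := CommRingCat.ofHom (res i.unop.le)

/-- The predicate cutting out the sections among all functions; it is local since `F ∈ Z`. -/
def localPredicate (hZ : generic D ∈ Z) : TopCat.LocalPredicate (fun _ : top Z => F) where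
  pred {U} f := f ∈ sections U
  res {_ _} i _ hf := (res i.le ⟨_, hf⟩).2
  locality {U} f h := by
    rcases isEmpty_or_nonempty U with hU | ⟨⟨x₀⟩⟩
    · exact ⟨0, fun x => hU.elim x⟩
    · have hg := generic_mem_opens hZ U x₀.2
      refine ⟨f ⟨_, hg⟩, fun x => ?_⟩
      obtain ⟨V, hxV, i, hV⟩ := h x
      have h1 := sections_apply_eq ⟨_, hV⟩ ⟨x.1, hxV⟩ ⟨_, generic_mem_opens hZ V hxV⟩
      have h2 := sections_apply_mem ⟨_, hV⟩ ⟨x.1, hxV⟩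
      have h3 : f x = f ⟨_, hg⟩ := h1
      exact ⟨h3, h3 ▸ h2⟩

theorem isSheaf_holomorphyPresheaf (hZ : generic D ∈ Z) :
    (holomorphyPresheaf Z).IsSheaf := by
  refine (TopCat.Presheaf.isSheaf_iff_isSheaf_comp (forget CommRingCat) _).mpr ?_
  refine TopCat.Presheaf.isSheaf_of_iso ?_ (TopCat.subsheafToTypes (localPredicate hZ)).property
  exact NatIso.ofComponents (fun _ => Iso.refl _) (by cat_disch)

/-- Evaluation at `x` of the sections over a neighbourhood of `x`. -/
def evalHom (U : Opens (top Z)) (x : top Z) (hx : x ∈ U) : sections U →+* x.1.1 where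
  toFun s := ⟨s.1 ⟨x, hx⟩, sections_apply_mem s ⟨x, hx⟩⟩
  map_one' := rfl
  map_mul' _ _ := rfl
  map_zero' := rfl
  map_add' _ _ := rfl

/-- The canonical map from the stalk of the holomorphy presheaf at the valuation ring `x`
to this valuation ring. -/
def stalkHom (x : top Z) : (holomorphyPresheaf Z).stalk x ⟶ CommRingCat.of x.1.1 :=
  Limits.colimit.desc ((OpenNhds.inclusion x).op ⋙ holomorphyPresheaf Z)
    { pt := _
      ι := { app := fun U =>
              CommRingCat.ofHom (evalHom ((OpenNhds.inclusion x).obj U.unop) x U.unop.2) } }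

theorem stalkHom_germ (U : Opens (top Z)) (x : top Z) (hx : x ∈ U) (s : sections U) :
    stalkHom x ((holomorphyPresheaf Z).germ U x hx s) = evalHom U x hx s := by
  have : (holomorphyPresheaf Z).germ U x hx ≫ stalkHom x = CommRingCat.ofHom (evalHom U x hx) :=
    Limits.colimit.ι_desc _ _
  exact congr_arg (fun f => f.hom s) this

theorem stalkHom_bijective (x : top Z) : Function.Bijective (stalkHom x) := by
  constructor
  · intro a b hab
    obtain ⟨U, hxU, s, rfl⟩ := (holomorphyPresheaf Z).exists_germ_eq a
    obtain ⟨V, hxV, t, rfl⟩ := (holomorphyPresheaf Z).exists_germ_eq b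
    have h : s.1 ⟨x, hxU⟩ = t.1 ⟨x, hxV⟩ := by
      have := congr_arg Subtype.val
        ((stalkHom_germ U x hxU s).symm.trans (hab.trans (stalkHom_germ V x hxV t)))
      exact this
    refine TopCat.Presheaf.germ_ext (C := CommRingCat) _ (U ⊓ V) ⟨hxU, hxV⟩
      (homOfLE inf_le_left) (homOfLE inf_le_right) ?_
    refine Subtype.ext (funext fun y => ?_)
    change s.1 ⟨y.1, y.2.1⟩ = t.1 ⟨y.1, y.2.2⟩
    rw [sections_apply_eq s _ ⟨x, hxU⟩, h, sections_apply_eq t _ ⟨y.1, y.2.2⟩]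
  · intro v
    let U : Opens (top Z) :=
      ⟨Subtype.val ⁻¹' basicOpen D {v.1}, (isOpen_basicOpen _).preimage continuous_subtype_val⟩
    have hx : x ∈ U := fun y hy => by rw [Finset.mem_singleton.mp hy]; exact v.2
    exact ⟨(holomorphyPresheaf Z).germ U x hx
      (constSection U v.1 fun y => y.2 v.1 (Finset.mem_singleton_self _)),
      stalkHom_germ U x hx _⟩

/-- The stalk of the holomorphy sheaf at a valuation ring in `Z` is this valuation ring. -/
def stalkEquiv (x : top Z) : (holomorphyPresheaf Z).stalk x ≃+* x.1.1 :=
  RingEquiv.ofBijective (stalkHom x).hom (stalkHom_bijective x)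

/-- The subspace `Z`, with `F ∈ Z`, of the Zariski-Riemann space of `F/D`, as a locally ringed
space whose structure sheaf is the holomorphy sheaf. -/
def space (Z : Set (ZariskiRiemann D)) (hZ : generic D ∈ Z) : LocallyRingedSpace.{u} where
  carrier := top Z
  presheaf := holomorphyPresheaf Z
  IsSheaf := isSheaf_holomorphyPresheaf hZ
  isLocalRing x := (stalkEquiv x).symm.isLocalRing

/-- The inclusion of a subspace into a larger one, as a morphism of presheafed spaces: the
underlying map is the inclusion, and sections over `U` are restricted to the points of the
smaller subspace. -/
def inclusionPre {Z Z' : Set (ZariskiRiemann D)} (hZ : generic D ∈ Z) (h : Z ⊆ Z') :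
    (space Z hZ).toPresheafedSpace ⟶ (space Z' (Set.mem_of_mem_of_subset hZ h)).toPresheafedSpace where
  base := TopCat.ofHom ⟨Set.inclusion h, continuous_inclusion h⟩
  c :=
    { app := fun U => CommRingCat.ofHom
        { toFun := fun s : sections U.unop =>
            (⟨fun x => s.1 ⟨Set.inclusion h x.1, x.2⟩,
              s.2.imp fun _ hc x => hc ⟨Set.inclusion h x.1, x.2⟩⟩ : sections _)
          map_one' := rfl
          map_mul' := fun _ _ => rfl
          map_zero' := rfl
          map_add' := fun _ _ => rfl } }

theorem stalkEquiv_inclusionPre {Z Z' : Set (ZariskiRiemann D)} (hZ : generic D ∈ Z) (h : Z ⊆ Z')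
    (x : top Z) (a : (holomorphyPresheaf Z').stalk (Set.inclusion h x)) :
    (stalkEquiv x ((inclusionPre hZ h).stalkMap x a) : F) =
      stalkEquiv (Set.inclusion h x : top Z') a := by
  obtain ⟨U, hxU, s, rfl⟩ := (holomorphyPresheaf Z').exists_germ_eq a
  have h1 := PresheafedSpace.stalkMap_germ_apply (inclusionPre hZ h) U x hxU s
  refine (congr_arg (fun b => (stalkEquiv x b : F)) h1).trans ?_
  refine (congr_arg Subtype.val (stalkHom_germ _ x hxU _)).trans ?_
  exact (congr_arg Subtype.val (stalkHom_germ U (Set.inclusion h x : top Z') hxU s)).symm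

/-- The inclusion of a subspace into a larger one, as a morphism of locally ringed spaces. -/
def inclusion {Z Z' : Set (ZariskiRiemann D)} (hZ : generic D ∈ Z) (h : Z ⊆ Z') :
    space Z hZ ⟶ space Z' (Set.mem_of_mem_of_subset hZ h) where
  toHom := inclusionPre hZ h
  prop x := by
    constructor
    intro a ha
    have ha' : IsUnit (stalkEquiv x ((inclusionPre hZ h).stalkMap x a)) := ha.map (stalkEquiv x)
    have key := stalkEquiv_inclusionPre hZ h x a
    have : IsUnit (stalkEquiv (Set.inclusion h x : top Z') a) := by
      have hx : stalkEquiv x ((inclusionPre hZ h).stalkMap x a) =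
          stalkEquiv (Set.inclusion h x : top Z') a := Subtype.ext key
      exact hx ▸ ha'
    exact (MulEquiv.isUnit_map (stalkEquiv (Set.inclusion h x : top Z'))).mp this

/-- The inclusion of `D` in the ring of global sections of the holomorphy sheaf. -/
def toGlobalSections (Z : Set (ZariskiRiemann D)) : D →+* sections (⊤ : Opens (top Z)) where
  toFun d := constSection ⊤ d.1 fun x => x.1.1.2 d.2
  map_one' := rfl
  map_mul' _ _ := rfl
  map_zero' := rfl
  map_add' _ _ := rfl

/-- The structure morphism `Z ⟶ Spec D`: the morphism that corresponds to the inclusion of `D` in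
the ring of global sections of `Z`. It sends a valuation ring to its center in `D`
(see `mem_center_iff`), and it is given by the inclusion maps on sections
(see `structureMorphism_globalSections`). -/
def structureMorphism (Z : Set (ZariskiRiemann D)) (hZ : generic D ∈ Z) :
    space Z hZ ⟶ (Spec (CommRingCat.of D)).toLocallyRingedSpace :=
  (space Z hZ).toΓSpec ≫ Spec.locallyRingedSpaceMap (CommRingCat.ofHom (toGlobalSections Z))

theorem structureMorphism_globalSections (hZ : generic D ∈ Z) :
    toSpecΓ (CommRingCat.of D) ≫ (structureMorphism Z hZ).c.app (op ⊤) =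
      CommRingCat.ofHom (toGlobalSections Z) :=
  congr_arg Quiver.Hom.unop
    ((ΓSpec.locallyRingedSpaceAdjunction.homEquiv (space Z hZ) (op (CommRingCat.of D))).left_inv
      (CommRingCat.ofHom (toGlobalSections Z)).op)

theorem mem_center_iff (hZ : generic D ∈ Z) (V : Z) (d : D) :
    d ∈ (((structureMorphism Z hZ).base (V : top Z)) : PrimeSpectrum D).asIdeal ↔
      (⟨d.1, V.1.2 d.2⟩ : V.1.1) ∈ IsLocalRing.maximalIdeal V.1.1 := by
  change ¬ IsUnit ((holomorphyPresheaf Z).germ ⊤ (V : top Z) trivial (toGlobalSections Z d)) ↔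
    ¬ IsUnit _
  rw [← MulEquiv.isUnit_map (stalkEquiv (V : top Z))]
  exact not_congr (iff_of_eq (congr_arg IsUnit (stalkHom_germ ⊤ (V : top Z) trivial _)))

end

end ZariskiRiemann

attribute [local instance] MvPolynomial.gradedAlgebra

/-- Projective `n`-space `Proj D[T₀, …, Tₙ]` over `D`. -/
def projectiveSpace (D : Type u) [CommRing D] (n : ℕ) : Scheme.{u} :=
  Proj (MvPolynomial.homogeneousSubmodule (Fin (n + 1)) D)

/-- The structure morphism of projective `n`-space over `D`. -/
def projectiveSpaceToSpec (D : Type u) [CommRing D] (n : ℕ) :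
    projectiveSpace D n ⟶ Spec (CommRingCat.of D) :=
  Proj.toSpecZero (MvPolynomial.homogeneousSubmodule (Fin (n + 1)) D) ≫
    Spec.map (CommRingCat.ofHom
      (algebraMap D (MvPolynomial.homogeneousSubmodule (Fin (n + 1)) D 0)))

/-- A morphism from `Z` to `ℙⁿ_D` is a `D`-morphism if it is compatible with the structure
morphisms to `Spec D`. -/
def IsDMorphism {F : Type u} [Field F] {D : Subring F} {Z : Set (ZariskiRiemann D)}
    {hZ : ZariskiRiemann.generic D ∈ Z} {n : ℕ}
    (φ : ZariskiRiemann.space Z hZ ⟶ (projectiveSpace D n).toLocallyRingedSpace) : Prop :=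
  φ ≫ (projectiveSpaceToSpec D n).toLRSHom = ZariskiRiemann.structureMorphism Z hZ

end

/-! The stalk of `Z` at `V` is `V` itself, so a morphism from `Z` to a scheme `X` induces morphisms
`Spec V ⟶ X`, one for each `V ∈ Z`. These determine it (`hom_ext_of_specMap`), and they all restrict
to one `F`-valued point of `X` (`SpecMap_toField_specMap`).

Let `X` be proper over `D`. By the valuative criterion, an `F`-valued point over `D` extends
uniquely to every `Spec V` (`exists_lift`, `lift_unique`). Sending `V` to the image of the closed
point is continuous because `X` is of finite type: if `V` is centered in an affine open set, the
coordinate ring has finitely many generators over `D`, and each `W` containing their values in `F`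
is centered there too (`exists_finset_forall_lift_mem`). The extensions therefore glue to a
morphism.

Thus `D`-morphisms from `Z` to `X` correspond to `F`-valued points of `X` over `D`, whatever `Z` is
(`hom_ext_of_fieldMap`, `exists_hom_fieldMap_eq`). Restriction from the whole space to `Z` preserves
this point, hence is bijective on `D`-morphisms. It remains to see that projective space is proper
over `D`. -/

noncomputable section

attribute [local instance] MvPolynomial.gradedAlgebra

/-! ### Morphisms from spectra of local rings -/

namespace AlgebraicGeometry.Scheme

/-- Composing with the germ map avoids a transport between the stalks at the two images of the
closed point. -/
theorem germ_stalkClosedPointTo_congr {X : Scheme.{u}} {R : CommRingCat.{u}} [IsLocalRing R]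
    {l l' : Spec R ⟶ X} (h : l = l') (U : X.Opens) (hl : l (IsLocalRing.closedPoint R) ∈ U)
    (hl' : l' (IsLocalRing.closedPoint R) ∈ U) :
    X.presheaf.germ U _ hl ≫ stalkClosedPointTo l =
      X.presheaf.germ U _ hl' ≫ stalkClosedPointTo l' := by
  subst h
  rfl

theorem germ_stalkClosedPointTo_SpecMap {R S : CommRingCat.{u}} [IsLocalRing R] [IsLocalRing S]
    (i : R ⟶ S) (U : (Spec R).Opens) (hU : IsLocalRing.closedPoint R ∈ U)
    (hU' : Spec.map i (IsLocalRing.closedPoint S) ∈ U) :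
    (Spec R).presheaf.germ U _ hU' ≫ stalkClosedPointTo (Spec.map i) =
      (Spec R).presheaf.germ U (IsLocalRing.closedPoint R) hU ≫
        (stalkClosedPointIso R).hom ≫ i := by
  obtain rfl : U = ⊤ := IsLocalRing.closed_point_mem_iff.mp hU
  rw [germ_stalkClosedPointTo_Spec, germ_stalkClosedPointIso_hom_assoc]

/-- Here `i` need not be local: the case of interest is the inclusion of a valuation ring in `F`. -/
theorem germ_stalkClosedPointTo_SpecMap_comp {X : Scheme.{u}} {R S : CommRingCat.{u}}
    [IsLocalRing R] [IsLocalRing S] (i : R ⟶ S) (l : Spec R ⟶ X) (U : X.Opens)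
    (hU : l (IsLocalRing.closedPoint R) ∈ U)
    (hU' : (Spec.map i ≫ l) (IsLocalRing.closedPoint S) ∈ U) :
    X.presheaf.germ U _ hU' ≫ stalkClosedPointTo (Spec.map i ≫ l) =
      X.presheaf.germ U _ hU ≫ stalkClosedPointTo l ≫ i := by
  have h1 := Hom.germ_stalkMap_assoc l U (Spec.map i (IsLocalRing.closedPoint S)) hU'
    (stalkClosedPointTo (Spec.map i))
  have h2 := Hom.germ_stalkMap_assoc l U (IsLocalRing.closedPoint R) hU
    ((stalkClosedPointIso R).hom ≫ i)
  have h3 := germ_stalkClosedPointTo_SpecMap i (l ⁻¹ᵁ U) hU hU'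
  refine ((congr_arg (fun g => X.presheaf.germ U _ hU' ≫ g)
    (stalkClosedPointTo_comp (Spec.map i) l)).trans h1).trans ?_
  refine ((congr_arg (fun g => l.app U ≫ g) h3).trans h2.symm).trans ?_
  simp only [stalkClosedPointTo, Category.assoc]

/-- This reduces a morphism whose closed point lands in an affine open set to a ring homomorphism
from the coordinate ring. -/
theorem SpecMap_germ_stalkClosedPointTo_fromSpec {X : Scheme.{u}} {R : CommRingCat.{u}}
    [IsLocalRing R] (l : Spec R ⟶ X) {U : X.Opens} (hU : IsAffineOpen U)
    (hl : l (IsLocalRing.closedPoint R) ∈ U) :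
    Spec.map (X.presheaf.germ U _ hl ≫ stalkClosedPointTo l) ≫ hU.fromSpec = l := by
  have h : Spec.map (X.presheaf.germ U _ hl) ≫ hU.fromSpec = X.fromSpecStalk _ :=
    hU.fromSpecStalk_eq_fromSpecStalk hl
  rw [Spec.map_comp, Category.assoc, h, Spec_stalkClosedPointTo_fromSpecStalk]

end AlgebraicGeometry.Scheme

/-! ### Morphisms out of `Z` and the induced morphisms from spectra of valuation rings -/

namespace ZariskiRiemann

variable {F : Type u} [Field F] {D : Subring F} {Z : Set (ZariskiRiemann D)}
  {hZ : generic D ∈ Z} {X : Scheme.{u}}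

/-- The valuation ring of `F` that a point of `Z` is. -/
def toVal (V : space Z hZ) : ValuationSubring F := Subtype.val (Subtype.val (V : Z))

/-- Evaluation of sections at a point. -/
def evalMap (U : Opens (space Z hZ)) (V : space Z hZ) (hV : V ∈ U) :
    (space Z hZ).presheaf.obj (op U) ⟶ CommRingCat.of (toVal V) :=
  CommRingCat.ofHom (evalHom U V hV)

theorem section_ext {U : Opens (space Z hZ)} {s t : (space Z hZ).presheaf.obj (op U)}
    (h : ∀ V hV, (evalMap U V hV s : F) = evalMap U V hV t) : s = t :=
  Subtype.ext (funext fun x => h x.1 x.2)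

theorem evalMap_eq {U : Opens (space Z hZ)} (s : (space Z hZ).presheaf.obj (op U))
    {V W : space Z hZ} (hV : V ∈ U) (hW : W ∈ U) :
    (evalMap U V hV s : F) = evalMap U W hW s :=
  sections_apply_eq _ _ _

/-- The canonical isomorphism of the stalk at `V` with the valuation ring `V`. -/
def stalkMapVal (V : space Z hZ) : (space Z hZ).presheaf.stalk V ⟶ CommRingCat.of (toVal V) :=
  stalkHom V

instance (V : space Z hZ) : IsLocalHom (stalkMapVal V).hom :=
  ⟨fun _ ha => (MulEquiv.isUnit_map (stalkEquiv (V : top Z))).mp ha⟩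

theorem germ_stalkMapVal (U : Opens (space Z hZ)) (V : space Z hZ) (hV : V ∈ U) :
    (space Z hZ).presheaf.germ U V hV ≫ stalkMapVal V = evalMap U V hV := by
  ext s
  exact congr_arg Subtype.val (stalkHom_germ U V hV s)

/-- The local homomorphism from the stalk of `X` at `φ V` to the valuation ring `V` that is induced
by a morphism `φ` to `X`. -/
def stalkTo (φ : space Z hZ ⟶ X.toLocallyRingedSpace) (V : space Z hZ) :
    X.presheaf.stalk (φ.base V) ⟶ CommRingCat.of (toVal V) :=
  LocallyRingedSpace.Hom.stalkMap φ V ≫ stalkMapVal V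

instance (φ : space Z hZ ⟶ X.toLocallyRingedSpace) (V : space Z hZ) :
    IsLocalHom (stalkTo φ V).hom :=
  RingHom.isLocalHom_comp (stalkMapVal V).hom (LocallyRingedSpace.Hom.stalkMap φ V).hom

theorem germ_stalkTo (φ : space Z hZ ⟶ X.toLocallyRingedSpace) (V : space Z hZ) (U : X.Opens)
    (hU : φ.base V ∈ U) :
    X.presheaf.germ U (φ.base V) hU ≫ stalkTo φ V = φ.c.app (op U) ≫
      evalMap ((Opens.map φ.base).obj U) V hU := by
  have h := germ_stalkMapVal ((Opens.map φ.base).obj U) V hU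
  exact (PresheafedSpace.stalkMap_germ_assoc φ.toHom U V hU (stalkMapVal V)).trans
    (congr_arg (fun f => φ.c.app (op U) ≫ f) h)

/-- The morphism from the spectrum of the valuation ring `V` to `X` that is induced by a morphism
to `X` from a space that contains `V`. -/
def specMap (φ : space Z hZ ⟶ X.toLocallyRingedSpace) (V : space Z hZ) :
    Spec (CommRingCat.of (toVal V)) ⟶ X :=
  Spec.map (stalkTo φ V) ≫ X.fromSpecStalk (φ.base V)

theorem specMap_closedPoint (φ : space Z hZ ⟶ X.toLocallyRingedSpace) (V : space Z hZ) :
    specMap φ V (IsLocalRing.closedPoint (CommRingCat.of (toVal V))) = φ.base V := by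
  have h1 := Scheme.Hom.comp_apply (Spec.map (stalkTo φ V)) (X.fromSpecStalk (φ.base V))
    (IsLocalRing.closedPoint (CommRingCat.of (toVal V)))
  have h2 : Spec.map (stalkTo φ V) (IsLocalRing.closedPoint (CommRingCat.of (toVal V))) = _ :=
    Spec_closedPoint
  exact h1.trans ((congr_arg _ h2).trans Scheme.fromSpecStalk_closedPoint)

/-- The inclusion of the valuation ring `V` in `F`. -/
def toField (V : space Z hZ) : CommRingCat.of (toVal V) ⟶ CommRingCat.of F :=
  CommRingCat.ofHom (toVal V).subtype

/-- The inclusion of `D` in the valuation ring `V`. -/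
def ofBase (V : space Z hZ) : CommRingCat.of D ⟶ CommRingCat.of (toVal V) :=
  CommRingCat.ofHom (Subring.inclusion (Subtype.val (V : Z)).2)

theorem ofBase_toField (V : space Z hZ) :
    ofBase V ≫ toField V = CommRingCat.ofHom D.subtype :=
  rfl

/-- The point `F` of a space that contains it. -/
def genericPt (Z : Set (ZariskiRiemann D)) (hZ : generic D ∈ Z) : space Z hZ :=
  (⟨generic D, hZ⟩ : Z)

theorem genericPt_specializes (V : space Z hZ) : genericPt Z hZ ⤳ V := by
  rw [specializes_iff_forall_open]
  exact fun s hs hV => generic_mem_opens hZ ⟨s, hs⟩ hV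

/-- The `F`-valued point of `X` that is induced by a morphism to `X`. -/
def fieldMap (φ : space Z hZ ⟶ X.toLocallyRingedSpace) : Spec (CommRingCat.of F) ⟶ X :=
  Spec.map (toField (genericPt Z hZ)) ≫ specMap φ (genericPt Z hZ)

/-- Sections on `Z` are constant functions, so evaluation at `V` and at the generic point agree in
`F`. -/
theorem SpecMap_toField_specMap (φ : space Z hZ ⟶ X.toLocallyRingedSpace) (V : space Z hZ) :
    Spec.map (toField V) ≫ specMap φ V = fieldMap φ := by
  have hs : φ.base (genericPt Z hZ) ⤳ φ.base V :=
    (genericPt_specializes V).map φ.base.hom.continuous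
  have h : stalkTo φ V ≫ toField V = X.presheaf.stalkSpecializes hs ≫
      stalkTo φ (genericPt Z hZ) ≫ toField (genericPt Z hZ) := by
    refine TopCat.Presheaf.stalk_hom_ext _ fun U hU => ?_
    have hU' : φ.base (genericPt Z hZ) ∈ U := hs.mem_open U.2 hU
    have h1 : X.presheaf.germ U (φ.base V) hU ≫ X.presheaf.stalkSpecializes hs =
        X.presheaf.germ U (φ.base (genericPt Z hZ)) hU' :=
      TopCat.Presheaf.germ_stalkSpecializes _ hU hs
    rw [reassoc_of% germ_stalkTo φ V U hU, reassoc_of% h1,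
      reassoc_of% germ_stalkTo φ (genericPt Z hZ) U hU']
    ext s
    exact evalMap_eq (φ.c.app (op U) s) _ _
  rw [fieldMap, specMap, specMap, ← Scheme.SpecMap_stalkSpecializes_fromSpecStalk hs,
    ← Spec.map_comp_assoc, ← Spec.map_comp_assoc, ← Spec.map_comp_assoc, h]

theorem specMap_comp {Y : Scheme.{u}} (φ : space Z hZ ⟶ X.toLocallyRingedSpace) (f : X ⟶ Y)
    (V : space Z hZ) : specMap (φ ≫ f.toLRSHom) V = specMap φ V ≫ f := by
  have h : stalkTo (φ ≫ f.toLRSHom) V = f.stalkMap (φ.base V) ≫ stalkTo φ V := by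
    refine TopCat.Presheaf.stalk_hom_ext _ fun U hU => ?_
    refine (germ_stalkTo _ V U hU).trans ?_
    have h1 := Scheme.Hom.germ_stalkMap_assoc f U (φ.base V) hU (stalkTo φ V)
    have h2 : X.presheaf.germ (f ⁻¹ᵁ U) (φ.base V) hU ≫ stalkTo φ V = _ :=
      germ_stalkTo φ V (f ⁻¹ᵁ U) hU
    exact (h1.trans (congr_arg (fun g => f.app U ≫ g) h2)).symm
  have h1 : specMap (φ ≫ f.toLRSHom) V =
      Spec.map (f.stalkMap (φ.base V) ≫ stalkTo φ V) ≫ Y.fromSpecStalk (f (φ.base V)) :=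
    congr_arg (fun g => Spec.map g ≫ Y.fromSpecStalk (f (φ.base V))) h
  rw [h1, Spec.map_comp, Category.assoc, specMap, Category.assoc,
    ← Scheme.SpecMap_stalkMap_fromSpecStalk]

theorem specMap_structureMorphism (V : space Z hZ) :
    specMap (X := Spec (CommRingCat.of D)) (structureMorphism Z hZ) V =
      Spec.map (ofBase V) := by
  have h := germ_stalkTo (X := Spec (CommRingCat.of D)) (structureMorphism Z hZ) V ⊤ trivial
  rw [specMap, Spec.fromSpecStalk_eq, ← Spec.map_comp, Category.assoc, h]
  congr 1
  have h1 := structureMorphism_globalSections (Z := Z) hZ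
  exact congr_arg (fun f => f ≫ evalMap ⊤ V trivial) h1

/-- The image of the closed point recovers the map on points; a section on `Z` is determined by its
values, which can be read off from `specMap`. -/
theorem hom_ext_of_specMap {φ ψ : space Z hZ ⟶ X.toLocallyRingedSpace}
    (h : ∀ V, specMap φ V = specMap ψ V) : φ = ψ := by
  have hb : φ.base = ψ.base := by
    ext V
    have h1 := specMap_closedPoint φ V
    rw [h, specMap_closedPoint] at h1
    exact h1.symm
  have key (χ : space Z hZ ⟶ X.toLocallyRingedSpace) (U : X.Opens) (V : space Z hZ)
      (hV : χ.base V ∈ U)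
      (hV' : specMap χ V (IsLocalRing.closedPoint (CommRingCat.of (toVal V))) ∈ U) :
      χ.c.app (op U) ≫ evalMap ((Opens.map χ.base).obj U) V hV =
        X.presheaf.germ U _ hV' ≫ Scheme.stalkClosedPointTo (specMap χ V) := by
    rw [← germ_stalkTo]
    exact (Scheme.germ_stalkClosedPointTo_Spec_fromSpecStalk (stalkTo χ V) U hV').symm
  have hmor : ∀ (U : X.Opens) (V : space Z hZ) (hV : φ.base V ∈ U) (hV' : ψ.base V ∈ U),
      φ.c.app (op U) ≫ evalMap ((Opens.map φ.base).obj U) V hV =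
      ψ.c.app (op U) ≫ evalMap ((Opens.map ψ.base).obj U) V hV' := by
    intro U V hV hV'
    have h1 := specMap_closedPoint φ V
    have h2 := specMap_closedPoint ψ V
    rw [key φ U V hV (h1.symm ▸ hV), key ψ U V hV' (h2.symm ▸ hV')]
    exact Scheme.germ_stalkClosedPointTo_congr (h V) U _ _
  -- The sheaf maps have the same type only once the maps on points are identified.
  obtain ⟨⟨b, c⟩, pφ⟩ := φ
  obtain ⟨⟨b', c'⟩, pψ⟩ := ψ
  obtain rfl : b = b' := hb
  obtain rfl : c = c' := by
    ext U s
    refine section_ext fun V hV => ?_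
    exact congr_arg (fun f => (f.hom s).1) (hmor U V hV hV)
  rfl

theorem specMap_inclusion {Z' : Set (ZariskiRiemann D)} (h : Z ⊆ Z')
    (φ : space Z' (Set.mem_of_mem_of_subset hZ h) ⟶ X.toLocallyRingedSpace) (V : space Z hZ) :
    specMap (inclusion hZ h ≫ φ) V = specMap φ ((inclusion hZ h).base V) := by
  have h' : stalkTo (inclusion hZ h ≫ φ) V = stalkTo φ ((inclusion hZ h).base V) := by
    refine TopCat.Presheaf.stalk_hom_ext _ fun U hU => ?_
    exact (germ_stalkTo (inclusion hZ h ≫ φ) V U hU).trans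
      (germ_stalkTo φ ((inclusion hZ h).base V) U hU).symm
  exact congr_arg (fun f => Spec.map f ≫ X.fromSpecStalk (φ.base ((inclusion hZ h).base V))) h'

theorem fieldMap_inclusion {Z' : Set (ZariskiRiemann D)} (h : Z ⊆ Z')
    (φ : space Z' (Set.mem_of_mem_of_subset hZ h) ⟶ X.toLocallyRingedSpace) :
    fieldMap (inclusion hZ h ≫ φ) = fieldMap φ :=
  congr_arg (fun f => Spec.map (toField (genericPt Z' _)) ≫ f)
    (specMap_inclusion h φ (genericPt Z hZ))

theorem inclusion_structureMorphism {Z' : Set (ZariskiRiemann D)} (hZ : generic D ∈ Z)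
    (h : Z ⊆ Z') : inclusion hZ h ≫ structureMorphism Z' (Set.mem_of_mem_of_subset hZ h) =
      structureMorphism Z hZ := by
  refine hom_ext_of_specMap (X := Spec (CommRingCat.of D)) fun V => ?_
  refine (specMap_inclusion (X := Spec (CommRingCat.of D)) h _ V).trans ?_
  refine (specMap_structureMorphism _).trans ?_
  exact (specMap_structureMorphism V).symm

/-! ### The valuative criterion over `D` -/

/-- Since `V` embeds in `F`, compatibility with `Spec D` can be tested at the generic point. -/
theorem comp_eq_SpecMap_ofBase {p : X ⟶ Spec (CommRingCat.of D)} {V : space Z hZ}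
    {l : Spec (CommRingCat.of (toVal V)) ⟶ X}
    (h : Spec.map (toField V) ≫ l ≫ p = Spec.map (CommRingCat.ofHom D.subtype)) :
    l ≫ p = Spec.map (ofBase V) := by
  obtain ⟨b, hb⟩ := Spec.map_surjective (l ≫ p)
  rw [← hb, ← Spec.map_comp] at h
  rw [← hb]
  congr 1
  ext d
  exact congr_arg (fun f => f.hom d) (Spec.map_injective h)

theorem lift_unique (p : X ⟶ Spec (CommRingCat.of D)) [IsSeparated p] {V : space Z hZ}
    {l l' : Spec (CommRingCat.of (toVal V)) ⟶ X}
    (h : Spec.map (toField V) ≫ l = Spec.map (toField V) ≫ l') (hp : l ≫ p = l' ≫ p) :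
    l = l' := by
  let S : ValuativeCommSq p :=
    { R := toVal V
      K := F
      i₁ := Spec.map (toField V) ≫ l
      i₂ := l ≫ p
      commSq := ⟨Category.assoc _ _ _⟩ }
  have hS := IsSeparated.valuativeCriterion p S
  exact congr_arg CommSq.LiftStruct.l
    (hS.elim (⟨l, rfl, rfl⟩ : S.commSq.LiftStruct) ⟨l', h.symm, hp.symm⟩)

theorem hom_ext_of_fieldMap (p : X ⟶ Spec (CommRingCat.of D)) [IsSeparated p]
    {φ ψ : space Z hZ ⟶ X.toLocallyRingedSpace}
    (hφ : φ ≫ p.toLRSHom = structureMorphism Z hZ) (hψ : ψ ≫ p.toLRSHom = structureMorphism Z hZ)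
    (h : fieldMap φ = fieldMap ψ) : φ = ψ := by
  refine hom_ext_of_specMap fun V => lift_unique p ?_ ?_
  · rw [SpecMap_toField_specMap, SpecMap_toField_specMap, h]
  · rw [← specMap_comp, ← specMap_comp, hφ, hψ]

theorem fieldMap_comp_eq (p : X ⟶ Spec (CommRingCat.of D))
    {φ : space Z hZ ⟶ X.toLocallyRingedSpace} (hφ : φ ≫ p.toLRSHom = structureMorphism Z hZ) :
    fieldMap φ ≫ p = Spec.map (CommRingCat.ofHom D.subtype) := by
  rw [fieldMap, Category.assoc, ← specMap_comp, hφ, specMap_structureMorphism, ← Spec.map_comp,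
    ofBase_toField]

theorem exists_lift (p : X ⟶ Spec (CommRingCat.of D)) [IsProper p]
    {g : Spec (CommRingCat.of F) ⟶ X}
    (hg : g ≫ p = Spec.map (CommRingCat.ofHom D.subtype)) (V : space Z hZ) :
    ∃ l : Spec (CommRingCat.of (toVal V)) ⟶ X, Spec.map (toField V) ≫ l = g := by
  let S : ValuativeCommSq p :=
    { R := toVal V
      K := F
      i₁ := g
      i₂ := Spec.map (ofBase V)
      commSq := ⟨by
        rw [hg]
        exact Spec.map_comp (ofBase V) (toField V)⟩ }
  have hE : ValuativeCriterion.Existence p := by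
    have h := ‹IsProper p›
    rw [IsProper.eq_valuativeCriterion] at h
    exact h.1.1.1.existence
  exact ⟨(hE S).exists_lift.some.l, (hE S).exists_lift.some.fac_left⟩

/-! ### Values at an `F`-valued point, and the finiteness behind continuity -/

/-- The values in `F` of the sections of `X` at an `F`-valued point of `X`. -/
def valueAt (g : Spec (CommRingCat.of F) ⟶ X) (U : X.Opens)
    (hU : g (IsLocalRing.closedPoint (CommRingCat.of F)) ∈ U) :
    X.presheaf.obj (op U) ⟶ CommRingCat.of F :=
  X.presheaf.germ U _ hU ≫ Scheme.stalkClosedPointTo g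

theorem closedPoint_mem_of_lift {g : Spec (CommRingCat.of F) ⟶ X} {V : space Z hZ}
    {l : Spec (CommRingCat.of (toVal V)) ⟶ X} (hl : Spec.map (toField V) ≫ l = g) {U : X.Opens}
    (hU : l (IsLocalRing.closedPoint (CommRingCat.of (toVal V))) ∈ U) :
    g (IsLocalRing.closedPoint (CommRingCat.of F)) ∈ U := by
  subst hl
  exact ((IsLocalRing.specializes_closedPoint (R := CommRingCat.of (toVal V))
    (Spec.map (toField V) (IsLocalRing.closedPoint (CommRingCat.of F)))).map
      l.continuous).mem_open U.2 hU

theorem germ_stalkClosedPointTo_toField {g : Spec (CommRingCat.of F) ⟶ X} {V : space Z hZ}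
    {l : Spec (CommRingCat.of (toVal V)) ⟶ X} (hl : Spec.map (toField V) ≫ l = g) {U : X.Opens}
    (hU : l (IsLocalRing.closedPoint (CommRingCat.of (toVal V))) ∈ U) :
    (X.presheaf.germ U _ hU ≫ Scheme.stalkClosedPointTo l) ≫ toField V =
      valueAt g U (closedPoint_mem_of_lift hl hU) := by
  have hU' := closedPoint_mem_of_lift hl hU
  subst hl
  rw [Category.assoc]
  exact (Scheme.germ_stalkClosedPointTo_SpecMap_comp (toField V) l U hU hU').symm

/-- Taking values at `g` is thus a homomorphism of `D`-algebras. -/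
theorem appLE_valueAt (p : X ⟶ Spec (CommRingCat.of D)) {g : Spec (CommRingCat.of F) ⟶ X}
    (hg : g ≫ p = Spec.map (CommRingCat.ofHom D.subtype)) {U : X.Opens} (hU : IsAffineOpen U)
    (hgU : g (IsLocalRing.closedPoint (CommRingCat.of F)) ∈ U) :
    ((Scheme.ΓSpecIso (CommRingCat.of D)).inv ≫ p.appLE ⊤ U le_top) ≫ valueAt g U hgU =
      CommRingCat.ofHom D.subtype := by
  apply Spec.map_injective
  have h1 := IsAffineOpen.SpecMap_appLE_fromSpec p (isAffineOpen_top _) hU le_top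
  rw [IsAffineOpen.fromSpec_top, Scheme.isoSpec_Spec_inv] at h1
  rw [Spec.map_comp, Spec.map_comp, h1, ← hg, ← Category.assoc]
  congr 1
  exact Scheme.SpecMap_germ_stalkClosedPointTo_fromSpec g hU hgU

/-- The set `t` consists of the values of algebra generators of an affine neighbourhood inside `U`,
and defines a basic open neighbourhood of `V`. -/
theorem exists_finset_forall_lift_mem (p : X ⟶ Spec (CommRingCat.of D)) [IsProper p]
    {g : Spec (CommRingCat.of F) ⟶ X}
    (hg : g ≫ p = Spec.map (CommRingCat.ofHom D.subtype)) {V : space Z hZ}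
    {l : Spec (CommRingCat.of (toVal V)) ⟶ X} (hl : Spec.map (toField V) ≫ l = g) {U : X.Opens}
    (hU : l (IsLocalRing.closedPoint (CommRingCat.of (toVal V))) ∈ U) :
    ∃ t : Finset F, (∀ x ∈ t, x ∈ toVal V) ∧ ∀ W : space Z hZ, (∀ x ∈ t, x ∈ toVal W) →
      ∀ m : Spec (CommRingCat.of (toVal W)) ⟶ X, Spec.map (toField W) ≫ m = g →
        m (IsLocalRing.closedPoint (CommRingCat.of (toVal W))) ∈ U := by
  classical
  obtain ⟨_, ⟨U', hU', rfl⟩, hlU', hU'U⟩ :=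
    X.isBasis_affineOpens.exists_subset_of_mem_open hU U.2
  replace hU' : IsAffineOpen U' := hU'
  have hgU' := closedPoint_mem_of_lift hl (U := U') hlU'
  have key := appLE_valueAt p hg hU' hgU'
  have hft : RingHom.FiniteType
      ((Scheme.ΓSpecIso (CommRingCat.of D)).inv ≫ p.appLE ⊤ U' le_top).hom :=
    (p.finiteType_appLE (isAffineOpen_top _) hU' le_top).comp
      (RingHom.FiniteType.of_surjective _ (ConcreteCategory.bijective_of_isIso
        (Scheme.ΓSpecIso (CommRingCat.of D)).inv).2)
  let := RingHom.toAlgebra ((Scheme.ΓSpecIso (CommRingCat.of D)).inv ≫ p.appLE ⊤ U' le_top).hom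
  obtain ⟨s, hs⟩ := (hft : Algebra.FiniteType D (X.presheaf.obj (op U')))
  refine ⟨s.image (valueAt g U' hgU'), ?_, ?_⟩
  · intro x hx
    obtain ⟨a, -, rfl⟩ := Finset.mem_image.mp hx
    -- The value is computed through `l`, hence lies in `V`.
    rw [← germ_stalkClosedPointTo_toField hl (U := U') hlU']
    exact Subtype.prop _
  · intro W hW m hm
    have hmem (a : X.presheaf.obj (op U')) : valueAt g U' hgU' a ∈ toVal W := by
      have ha : a ∈ Algebra.adjoin D (s : Set (X.presheaf.obj (op U'))) := hs ▸ trivial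
      induction ha using Algebra.adjoin_induction with
      | mem x hx => exact hW _ (Finset.mem_image_of_mem _ hx)
      | algebraMap r =>
        have h : valueAt g U' hgU' (algebraMap D (X.presheaf.obj (op U')) r) = r.1 :=
          congr_arg (fun f => f.hom r) key
        rw [h]
        exact (ofBase W r).2
      | add x y _ _ hx hy =>
        rw [map_add]
        exact add_mem hx hy
      | mul x y _ _ hx hy =>
        rw [map_mul]
        exact mul_mem hx hy
    -- All values lie in `W`, so `g` extends to `Spec W` through `U'`; by separatedness `m` is this
    -- extension.
    let β : X.presheaf.obj (op U') ⟶ CommRingCat.of (toVal W) :=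
      CommRingCat.ofHom ((valueAt g U' hgU').hom.codRestrict (toVal W).toSubring hmem)
    have hβ : Spec.map (toField W) ≫ Spec.map β ≫ hU'.fromSpec = g := by
      rw [← Spec.map_comp_assoc]
      exact Scheme.SpecMap_germ_stalkClosedPointTo_fromSpec g hU' hgU'
    have hmβ : m = Spec.map β ≫ hU'.fromSpec := by
      refine lift_unique p (hm.trans hβ.symm) ?_
      rw [comp_eq_SpecMap_ofBase (l := m), comp_eq_SpecMap_ofBase]
      · rw [Category.assoc, reassoc_of% hβ, hg]
      · rw [reassoc_of% hm, hg]
    apply hU'U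
    have h1 : Set.range hU'.fromSpec = U' := hU'.range_fromSpec
    rw [hmβ, ← h1]
    exact ⟨_, (Scheme.Hom.comp_apply (Spec.map β) hU'.fromSpec _).symm⟩

/-! ### Gluing morphisms from the spectra of the valuation rings -/

section OfLifts

variable {g : Spec (CommRingCat.of F) ⟶ X}
  (l : ∀ V : space Z hZ, Spec (CommRingCat.of (toVal V)) ⟶ X)

/-- The image of the closed point under the given morphism from the spectrum of `V`. -/
def liftCenter (V : space Z hZ) : X :=
  l V (IsLocalRing.closedPoint (CommRingCat.of (toVal V)))

theorem continuous_liftCenter (p : X ⟶ Spec (CommRingCat.of D)) [IsProper p]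
    (hg : g ≫ p = Spec.map (CommRingCat.ofHom D.subtype))
    (hl : ∀ V, Spec.map (toField V) ≫ l V = g) : Continuous (liftCenter l) := by
  refine continuous_def.mpr fun U hU => isOpen_iff_forall_mem_open.mpr fun V hV => ?_
  obtain ⟨t, htV, ht⟩ := exists_finset_forall_lift_mem p hg (hl V) (U := ⟨U, hU⟩) hV
  exact ⟨Subtype.val ⁻¹' basicOpen D t, fun W hW => ht W hW (l W) (hl W),
    (isOpen_basicOpen t).preimage continuous_subtype_val, htV⟩

/-- The continuous map underlying the morphism that is given by compatible morphisms from the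
spectra of the valuation rings. -/
def liftBase (hc : Continuous (liftCenter l)) :
    (space Z hZ).carrier ⟶ X.carrier :=
  TopCat.ofHom ⟨liftCenter l, hc⟩

/-- The value at `V` of a section, computed by means of the morphism from the spectrum of `V`. -/
def liftValue (U : X.Opens) (V : space Z hZ) (hV : liftCenter l V ∈ U) :
    X.presheaf.obj (op U) ⟶ CommRingCat.of (toVal V) :=
  X.presheaf.germ U (liftCenter l V) hV ≫ Scheme.stalkClosedPointTo (l V)

variable {l} in
theorem liftValue_mem_sections (hl : ∀ V, Spec.map (toField V) ≫ l V = g)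
    (hc : Continuous (liftCenter l)) (U : X.Opens) (s : X.presheaf.obj (op U)) :
    (fun V => (liftValue l U V.1 V.2 s : F)) ∈
      sections (D := D) (Z := Z) ((Opens.map (liftBase l hc)).obj U) := by
  rcases isEmpty_or_nonempty ((Opens.map (liftBase l hc)).obj U) with hU | ⟨⟨V₀, hV₀⟩⟩
  · exact ⟨0, fun V => hU.elim V⟩
  · have hgU : g (IsLocalRing.closedPoint (CommRingCat.of F)) ∈ U :=
      closedPoint_mem_of_lift (hl V₀) hV₀
    -- The constant is the value at `g`, which every `l V` restricts to.
    refine ⟨valueAt g U hgU s, fun V => ?_⟩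
    have h : (liftValue l U V.1 V.2 s : F) = valueAt g U hgU s :=
      congr_arg (fun f => f.hom s) (germ_stalkClosedPointTo_toField (hl V.1) (U := U) V.2)
    exact ⟨h, h ▸ (liftValue l U V.1 V.2 s).2⟩

variable {l} in
/-- The morphism of presheafed spaces that is given by compatible morphisms from the spectra of
the valuation rings. -/
def liftHomPre (hl : ∀ V, Spec.map (toField V) ≫ l V = g) (hc : Continuous (liftCenter l)) :
    (space Z hZ).toPresheafedSpace ⟶ X.toPresheafedSpace where
  base := liftBase l hc
  c :=
    { app := fun U => CommRingCat.ofHom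
        { toFun := fun s =>
            (⟨fun V => (liftValue l U.unop V.1 V.2 s : F),
              liftValue_mem_sections hl hc U.unop s⟩ :
              sections ((Opens.map (liftBase l hc)).obj U.unop))
          map_one' := Subtype.ext (funext fun V => by simp)
          map_mul' := fun _ _ => Subtype.ext (funext fun V => by simp)
          map_zero' := Subtype.ext (funext fun V => by simp)
          map_add' := fun _ _ => Subtype.ext (funext fun V => by simp) }
      naturality := fun U U' i => by
        ext s
        refine Subtype.ext (funext fun V => ?_)
        have h := X.presheaf.germ_res_apply i.unop (liftCenter l V.1) V.2 s
        exact congr_arg (fun a => (Scheme.stalkClosedPointTo (l V.1) a : F)) h }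

/-- This yields both that the stalk maps are local and that `specMap` recovers `l`. -/
theorem stalkMap_liftHomPre (hl : ∀ V, Spec.map (toField V) ≫ l V = g)
    (hc : Continuous (liftCenter l)) (V : space Z hZ) :
    (liftHomPre hl hc).stalkMap V ≫ stalkMapVal V = Scheme.stalkClosedPointTo (l V) := by
  refine TopCat.Presheaf.stalk_hom_ext _ fun U hU => ?_
  refine (PresheafedSpace.stalkMap_germ_assoc (liftHomPre hl hc) U V hU (stalkMapVal V)).trans ?_
  refine (congr_arg (fun f => (liftHomPre hl hc).c.app (op U) ≫ f)
    (germ_stalkMapVal ((Opens.map (liftBase l hc)).obj U) V hU)).trans ?_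
  rfl

variable {l} in
/-- The morphism that is given by compatible morphisms from the spectra of the valuation rings. -/
def liftHom (hl : ∀ V, Spec.map (toField V) ≫ l V = g) (hc : Continuous (liftCenter l)) :
    space Z hZ ⟶ X.toLocallyRingedSpace where
  toHom := liftHomPre hl hc
  prop V := by
    have h1 : (stalkMapVal V).hom.comp ((liftHomPre hl hc).stalkMap V).hom = _ :=
      congr_arg CommRingCat.Hom.hom (stalkMap_liftHomPre l hl hc V)
    have h2 := Scheme.isLocalHom_stalkClosedPointTo (R := CommRingCat.of (toVal V)) (l V)
    have : IsLocalHom ((stalkMapVal V).hom.comp ((liftHomPre hl hc).stalkMap V).hom) := by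
      rw [h1]
      exact h2
    exact isLocalHom_of_comp _ (stalkMapVal V).hom

theorem specMap_liftHom (hl : ∀ V, Spec.map (toField V) ≫ l V = g)
    (hc : Continuous (liftCenter l)) (V : space Z hZ) : specMap (liftHom hl hc) V = l V :=
  (congr_arg (fun f => Spec.map f ≫ X.fromSpecStalk (liftCenter l V))
    (stalkMap_liftHomPre l hl hc V)).trans (Scheme.Spec_stalkClosedPointTo_fromSpecStalk (l V))

end OfLifts

/-- Morphisms to a proper scheme over `D` can be prescribed at the generic point. -/
theorem exists_hom_fieldMap_eq (p : X ⟶ Spec (CommRingCat.of D)) [IsProper p]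
    {g : Spec (CommRingCat.of F) ⟶ X} (hg : g ≫ p = Spec.map (CommRingCat.ofHom D.subtype)) :
    ∃ ψ : space Z hZ ⟶ X.toLocallyRingedSpace,
      ψ ≫ p.toLRSHom = structureMorphism Z hZ ∧ fieldMap ψ = g := by
  choose l hl using fun V : space Z hZ => exists_lift p hg V
  have hc := continuous_liftCenter l p hg hl
  refine ⟨liftHom hl hc, hom_ext_of_specMap (X := Spec (CommRingCat.of D)) fun V => ?_, ?_⟩
  · rw [specMap_comp, specMap_structureMorphism, specMap_liftHom]
    apply comp_eq_SpecMap_ofBase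
    rw [reassoc_of% hl V, hg]
  · rw [fieldMap, specMap_liftHom, hl]

end ZariskiRiemann

/-! ### Properness of projective space, and the theorem -/

instance (D : Type u) [CommRing D] (n : ℕ) : IsProper (projectiveSpaceToSpec D n) := by
  let 𝒜 := MvPolynomial.homogeneousSubmodule (Fin (n + 1)) D
  -- Polynomials of degree zero are constants, so the second factor of the structure morphism is an
  -- isomorphism; the first is proper by finite generation over `𝒜 0`.
  have hb : Function.Bijective (algebraMap D (𝒜 0)) := by
    constructor
    · intro a b h
      exact MvPolynomial.C_injective (Fin (n + 1)) D (congr_arg Subtype.val h)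
    · rintro ⟨x, hx⟩
      have hx' : x.IsHomogeneous 0 := hx
      refine ⟨x.coeff 0, Subtype.ext ?_⟩
      exact (MvPolynomial.totalDegree_eq_zero_iff_eq_C.mp
        (Nat.le_zero.mp hx'.totalDegree_le)).symm
  have : IsScalarTower D (𝒜 0) (MvPolynomial (Fin (n + 1)) D) :=
    ⟨fun d a x => smul_mul_assoc d a.1 x⟩
  have : Algebra.FiniteType (𝒜 0) (MvPolynomial (Fin (n + 1)) D) :=
    Algebra.FiniteType.of_restrictScalars_finiteType D _ _
  have : IsIso (CommRingCat.ofHom (algebraMap D (𝒜 0))) :=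
    (ConcreteCategory.isIso_iff_bijective _).mpr hb
  have h : IsProper (Proj.toSpecZero 𝒜 ≫
    Spec.map (CommRingCat.ofHom (algebraMap D (𝒜 0)))) := inferInstance
  exact h

theorem corollary2p4 {F : Type u} [Field F] (D : Subring F) (Z : Set (ZariskiRiemann D))
    (hZ : ZariskiRiemann.generic D ∈ Z) (n : ℕ)
    (φ : ZariskiRiemann.space Z hZ ⟶ (projectiveSpace D n).toLocallyRingedSpace)
    (hφ : IsDMorphism φ) :
    ∃! ψ : ZariskiRiemann.space (Set.univ : Set (ZariskiRiemann D)) (Set.mem_univ _) ⟶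
        (projectiveSpace D n).toLocallyRingedSpace,
      IsDMorphism ψ ∧ ZariskiRiemann.inclusion hZ (Set.subset_univ Z) ≫ ψ = φ := by
  open ZariskiRiemann in
  -- The `F`-valued point of `φ` is extended to the whole space; both remaining claims compare
  -- `F`-valued points.
  obtain ⟨ψ, hψ, hψφ⟩ := exists_hom_fieldMap_eq (Z := Set.univ) (hZ := Set.mem_univ _)
    (projectiveSpaceToSpec D n) (fieldMap_comp_eq _ hφ)
  refine ⟨ψ, ⟨hψ, ?_⟩, ?_⟩
  · refine hom_ext_of_fieldMap (projectiveSpaceToSpec D n) ?_ hφ ?_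
    · rw [Category.assoc, hψ]
      exact inclusion_structureMorphism hZ (Set.subset_univ Z)
    · rw [fieldMap_inclusion, hψφ]
  · rintro ψ' ⟨hψ', rfl⟩
    refine hom_ext_of_fieldMap (projectiveSpaceToSpec D n) hψ' hψ ?_
    rw [hψφ, fieldMap_inclusion]

end
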